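/- A $G_2$-structure on a $7$-dimensional manifold is a $3$-form $\psi$ which at each point $p$ is positive, that is, $\psi_p=f^*\varphi$ for some linear isomorphism $f:T_pM\to\mathbb{R}^7$, where $$\varphi=e^{127}+e^{347}+e^{567}+e^{135}-e^{146}-e^{236}-e^{245}.$$ It determines a Riemannian metric $g_\psi$, given at $p$ by the pull-back under $f$ of the standard inner product of $\mathbb{R}^7$ (this does not depend on the choice of $f$). Let $\mathrm{Ric}(\psi)$ and $\mathrm{scal}(\psi)$ denote the Ricci operator and the scalar curvature of $g_\psi$, and let $|\mathrm{Ric}(\psi)|=\sqrt{\mathrm{tr}\,\mathrm{Ric}(\psi)^2}$ be the norm of the Ricci operator with respect to $g_\psi$; if $\psi$ is a left-invariant $G_2$-structure on a Lie group, then $|\mathrm{Ric}(\psi)|$ and $\mathrm{scal}(\psi)$ are constant functions. A Lie group $S$ with Lie algebra $\mathfrak{s}$ is called solvable if $\mathfrak{s}$ is solvable, and a solvable Lie group $S$ is said to be of real type if, for every $X\in\mathfrak{s}$, either $\mathrm{ad}\,X$ is nilpotent or some complex eigenvalue of $\mathrm{ad}\,X$ has non-zero real part. **Corollary.** Let $S$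 be a non-abelian solvable real Lie group of dimension $7$ which is of real type. Then there exists a constant $C(S)>0$, depending only on $S$, such that $$|\mathrm{Ric}(\psi)|\le C(S)\,|\mathrm{scal}(\psi)|$$ for every left-invariant $G_2$-structure $\psi$ on $S$ (closed or not). -/

import Mathlib

open scoped Manifold ContDiff

noncomputable section

/-! ## Inner products on a real Lie algebra and the curvature of the left-invariant metrics -/

/-- An inner product on a real vector space. On the Lie algebra of a Lie group this is the same
thing as a left-invariant Riemannian metric on the group. -/
structure InnerMetric (V : Type*) [AddCommGroup V] [Module ℝ V] where
  /-- the underlying bilinear form -/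
  form : LinearMap.BilinForm ℝ V
  symm : ∀ x y, form x y = form y x
  pos : ∀ x, x ≠ 0 → 0 < form x x

namespace InnerMetric

section VectorSpace

variable {V : Type*} [AddCommGroup V] [Module ℝ V]

theorem nondegenerate (g : InnerMetric V) : g.form.Nondegenerate := by
  constructor
  · intro x hx
    by_contra h
    exact (g.pos x h).ne' (hx x)
  · intro x hx
    by_contra h
    exact (g.pos x h).ne' (hx x)

/-- The norm `|A| = √(tr (A* A))` of an endomorphism, `A*` being the adjoint with respect
to `g`. -/
def endNorm (g : InnerMetric V) [FiniteDimensional ℝ V] (A : V →ₗ[ℝ] V) : ℝ :=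
  Real.sqrt (LinearMap.trace ℝ V
    ((g.form.leftAdjointOfNondegenerate g.nondegenerate A) ∘ₗ A))

end VectorSpace

variable {L : Type*} [LieRing L] [LieAlgebra ℝ L]

/-- Half of the right-hand side of the Koszul formula for left-invariant vector fields `x`, `y`,
as a linear form in the third vector field:
`z ↦ ½ (g([x, y], z) - g([y, z], x) + g([z, x], y))`. -/
def koszul (g : InnerMetric L) (x y : L) : Module.Dual ℝ L where
  toFun z := (1 / 2) * (g.form ⁅x, y⁆ z - g.form ⁅y, z⁆ x + g.form ⁅z, x⁆ y)
  map_add' z w := by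
    simp only [map_add, lie_add, add_lie, LinearMap.add_apply]; ring
  map_smul' c z := by
    simp only [map_smul, lie_smul, smul_lie, LinearMap.smul_apply, smul_eq_mul, RingHom.id_apply]
    ring

variable [FiniteDimensional ℝ L]

/-- The Levi-Civita connection `∇ x y` of the left-invariant metric `g`, on left-invariant vector
fields: the left-invariant vector field with
`2 g(∇ x y, z) = g([x, y], z) - g([y, z], x) + g([z, x], y)`. -/
def leviCivita (g : InnerMetric L) : L →ₗ[ℝ] L →ₗ[ℝ] L :=
  LinearMap.mk₂ ℝ (fun x y => (g.form.toDual g.nondegenerate).symm (g.koszul x y))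
    (fun x x' y => by
      rw [← map_add]; congr 1; ext z
      simp only [koszul, map_add, lie_add, add_lie, LinearMap.add_apply, LinearMap.coe_mk,
        AddHom.coe_mk]
      ring)
    (fun c x y => by
      rw [← map_smul]; congr 1; ext z
      simp only [koszul, map_smul, lie_smul, smul_lie, LinearMap.smul_apply, LinearMap.coe_mk,
        AddHom.coe_mk, smul_eq_mul]
      ring)
    (fun x y y' => by
      rw [← map_add]; congr 1; ext z
      simp only [koszul, map_add, lie_add, add_lie, LinearMap.add_apply, LinearMap.coe_mk,
        AddHom.coe_mk]
      ring)
    (fun c x y => by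
      rw [← map_smul]; congr 1; ext z
      simp only [koszul, map_smul, lie_smul, smul_lie, LinearMap.smul_apply, LinearMap.coe_mk,
        AddHom.coe_mk, smul_eq_mul]
      ring)

theorem form_leviCivita (g : InnerMetric L) (x y z : L) :
    g.form (g.leviCivita x y) z =
      (1 / 2) * (g.form ⁅x, y⁆ z - g.form ⁅y, z⁆ x + g.form ⁅z, x⁆ y) := by
  simp [leviCivita, koszul]

/-- The connection `∇` is compatible with the metric. -/
theorem leviCivita_metric (g : InnerMetric L) (x y z : L) :
    g.form (g.leviCivita x y) z + g.form y (g.leviCivita x z) = 0 := by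
  rw [g.symm y, form_leviCivita, form_leviCivita, ← lie_skew x y, ← lie_skew x z, ← lie_skew z y]
  simp only [map_neg, LinearMap.neg_apply]
  ring

/-- The connection `∇` is torsion-free. -/
theorem leviCivita_torsion (g : InnerMetric L) (x y : L) :
    g.leviCivita x y - g.leviCivita y x = ⁅x, y⁆ := by
  rw [← sub_eq_zero]
  refine g.nondegenerate.1 _ fun z => ?_
  rw [map_sub, map_sub, LinearMap.sub_apply, LinearMap.sub_apply, form_leviCivita, form_leviCivita,
    ← lie_skew y x, ← lie_skew x z, ← lie_skew z y]
  simp only [map_neg, LinearMap.neg_apply]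
  ring

/-- The curvature tensor `R(x, y) = ∇ x ∇ y - ∇ y ∇ x - ∇ [x, y]`. -/
def curvature (g : InnerMetric L) (x y : L) : L →ₗ[ℝ] L :=
  g.leviCivita x ∘ₗ g.leviCivita y - g.leviCivita y ∘ₗ g.leviCivita x - g.leviCivita ⁅x, y⁆

/-- The Ricci tensor `ric(x, y) = tr (z ↦ R(z, x) y)`. -/
def ricci (g : InnerMetric L) (x y : L) : ℝ :=
  LinearMap.trace ℝ L
    { toFun := fun z => g.curvature z x y
      map_add' := fun z w => by
        simp only [curvature, map_add, add_lie, LinearMap.sub_apply, LinearMap.comp_apply,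
          LinearMap.add_apply]
        abel
      map_smul' := fun c z => by
        simp only [curvature, map_smul, smul_lie, LinearMap.sub_apply, LinearMap.comp_apply,
          LinearMap.smul_apply, RingHom.id_apply, smul_sub] }

/-- The Ricci tensor as a bilinear form. -/
def ricciForm (g : InnerMetric L) : LinearMap.BilinForm ℝ L :=
  LinearMap.mk₂ ℝ g.ricci
    (fun x x' y => by
      unfold ricci; rw [← map_add]; congr 1; ext z
      simp only [curvature, map_add, lie_add, LinearMap.sub_apply, LinearMap.comp_apply,
          LinearMap.add_apply, LinearMap.coe_mk, AddHom.coe_mk]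
      abel)
    (fun c x y => by
      unfold ricci; rw [← map_smul]; congr 1; ext z
      simp only [curvature, map_smul, lie_smul, LinearMap.sub_apply, LinearMap.comp_apply,
          LinearMap.smul_apply, LinearMap.coe_mk, AddHom.coe_mk, smul_sub])
    (fun x y y' => by
      unfold ricci; rw [← map_add]; congr 1; ext z
      simp only [map_add, LinearMap.add_apply, LinearMap.coe_mk, AddHom.coe_mk])
    (fun c x y => by
      unfold ricci; rw [← map_smul]; congr 1; ext z
      simp only [map_smul, LinearMap.smul_apply, LinearMap.coe_mk, AddHom.coe_mk])

/-- The Ricci operator: `g (Ric x, y) = ric (x, y)`. -/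
def ricciOp (g : InnerMetric L) : L →ₗ[ℝ] L :=
  (g.form.toDual g.nondegenerate).symm.toLinearMap ∘ₗ g.ricciForm

theorem form_ricciOp (g : InnerMetric L) (x y : L) :
    g.form (g.ricciOp x) y = g.ricci x y := by
  simp [ricciOp, ricciForm]

/-- The scalar curvature, i.e. the trace of the Ricci operator. -/
def scal (g : InnerMetric L) : ℝ := LinearMap.trace ℝ L g.ricciOp

/-- The norm of the Ricci operator. -/
def ricciNorm (g : InnerMetric L) : ℝ := g.endNorm g.ricciOp

end InnerMetric

/-! ## `G₂`-structures -/

/-- The `3`-form `e^i ∧ e^j ∧ e^k` on `ℝ⁷`. -/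
def wedge3 (i j k : Fin 7) : (Fin 7 → ℝ) [⋀^Fin 3]→ₗ[ℝ] ℝ :=
  (Matrix.detRowAlternating (n := Fin 3) (R := ℝ)).compLinearMap (LinearMap.funLeft ℝ ℝ ![i, j, k])

/-- The standard positive `3`-form on `ℝ⁷`,
`e^127 + e^347 + e^567 + e^135 - e^146 - e^236 - e^245`
(indices start from `0` in the code). -/
def stdG2Form : (Fin 7 → ℝ) [⋀^Fin 3]→ₗ[ℝ] ℝ :=
  wedge3 0 1 6 + wedge3 2 3 6 + wedge3 4 5 6 + wedge3 0 2 4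
    - wedge3 0 3 5 - wedge3 1 2 5 - wedge3 1 3 4

/-- The coframe `f` is adapted to the `3`-form `ψ`: it carries `ψ` to the standard positive
`3`-form. -/
def IsG2Coframe {V : Type*} [AddCommGroup V] [Module ℝ V] (ψ : V [⋀^Fin 3]→ₗ[ℝ] ℝ)
    (f : V ≃ₗ[ℝ] (Fin 7 → ℝ)) : Prop :=
  ψ = stdG2Form.compLinearMap f.toLinearMap

/-- Positive `3`-forms: those in the `GL₇(ℝ)`-orbit of the standard one. -/
def IsPositiveForm {V : Type*} [AddCommGroup V] [Module ℝ V] (ψ : V [⋀^Fin 3]→ₗ[ℝ] ℝ) : Prop :=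
  ∃ f : V ≃ₗ[ℝ] (Fin 7 → ℝ), IsG2Coframe ψ f

/-- `g` is the inner product attached to the positive `3`-form `ψ`: the one that makes an adapted
coframe orthonormal. (It does not depend on the adapted coframe, as the stabilizer of the standard
positive `3`-form is contained in `O(7)`.) -/
def IsMetricOf {V : Type*} [AddCommGroup V] [Module ℝ V] (g : InnerMetric V)
    (ψ : V [⋀^Fin 3]→ₗ[ℝ] ℝ) : Prop :=
  ∃ f : V ≃ₗ[ℝ] (Fin 7 → ℝ), IsG2Coframe ψ f ∧ ∀ x y, g.form x y = ∑ i, f x i * f y i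

theorem IsPositiveForm.exists_isMetricOf {V : Type*} [AddCommGroup V] [Module ℝ V]
    {ψ : V [⋀^Fin 3]→ₗ[ℝ] ℝ} (h : IsPositiveForm ψ) : ∃ g : InnerMetric V, IsMetricOf g ψ := by
  obtain ⟨f, hf⟩ := h
  refine ⟨⟨LinearMap.mk₂ ℝ (fun x y => ∑ i, f x i * f y i) ?_ ?_ ?_ ?_, ?_, ?_⟩, f, hf, ?_⟩
  · intro x x' y; simp [add_mul, Finset.sum_add_distrib]
  · intro c x y; simp [mul_assoc, Finset.mul_sum]
  · intro x y y'; simp [mul_add, Finset.sum_add_distrib]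
  · intro c x y; simp [mul_left_comm, Finset.mul_sum]
  · intro x y; simp [mul_comm]
  · intro x hx
    simp only [LinearMap.mk₂_apply]
    refine lt_of_le_of_ne (Finset.sum_nonneg fun i _ => mul_self_nonneg _) fun h0 => hx ?_
    rw [eq_comm, Finset.sum_eq_zero_iff_of_nonneg fun i _ => mul_self_nonneg _] at h0
    refine f.injective ?_
    rw [map_zero]
    ext i
    simpa using h0 i (Finset.mem_univ i)
  · intro x y; rfl

/-! ## Lie groups -/

/-- A solvable real Lie algebra is of real type when, for every `x`, either `ad x` is nilpotent or
`ad x` has a complex eigenvalue that is not purely imaginary. -/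
def IsOfRealType (L : Type*) [LieRing L] [LieAlgebra ℝ L] : Prop :=
  ∀ x : L, IsNilpotent (LieAlgebra.ad ℝ L x) ∨
    ∃ z : ℂ, Module.End.HasEigenvalue ((LieAlgebra.ad ℝ L x).baseChange ℂ) z ∧ z.re ≠ 0

/-- The model space of `7`-dimensional manifolds. -/
abbrev E7 : Type := EuclideanSpace ℝ (Fin 7)

/-- This makes a smooth real Lie group satisfy the regularity hypothesis under which its Lie
algebra `GroupLieAlgebra` is defined in the library. -/
instance instLEInftyMinSmoothness : ENat.LEInfty (minSmoothness ℝ 3) where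
  out := by
    rw [minSmoothness_of_isRCLikeNormedField]
    exact ENat.LEInfty.out

instance instFiniteDimensionalTangentSpace {S : Type*} [TopologicalSpace S] [ChartedSpace E7 S]
    (x : S) : FiniteDimensional ℝ (TangentSpace 𝓘(ℝ, E7) x) :=
  inferInstanceAs (FiniteDimensional ℝ E7)

/-- A left-invariant `G₂`-structure on a `7`-dimensional Lie group: a field of positive `3`-forms
that is invariant under all left translations (such a field is automatically smooth). -/
structure LeftInvariantG2Structure (S : Type*) [TopologicalSpace S] [ChartedSpace E7 S]
    [Group S] where
  /-- the `3`-form -/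
  form : ∀ x : S, (TangentSpace 𝓘(ℝ, E7) x) [⋀^Fin 3]→ₗ[ℝ] ℝ
  positive : ∀ x, IsPositiveForm (form x)
  leftInvariant : ∀ (a x : S) (v : Fin 3 → TangentSpace 𝓘(ℝ, E7) x),
    form (a * x) (fun i => mfderiv 𝓘(ℝ, E7) 𝓘(ℝ, E7) (fun y : S => a * y) x (v i)) = form x v

end

/-! The estimate is proved for every inner product on the Lie algebra, with one constant for all of
them. In an orthonormal basis with structure constants `c`, Ricci is quadratic in `c`, so its norm
is at most a dimensional constant times `|c|²`. Moreover `-scal = ¼|c|² + ½ ∑ tr (ad b i)² + |H|²`,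
where `H` is the mean curvature vector. It remains to bound `|c|²` by the first two terms, although
the trace may be negative.

Two facts give this. By Lie's theorem `tr (ad x)²` is the sum of the squares of the roots at `x`.
Real type says that the roots vanish wherever their real parts do, so the imaginary parts are fixed
linear combinations of the real parts. Real parts of eigenvalues are controlled by the symmetric
part of `ad x` for any inner product, hence so is `-tr (ad x)²` (`IsOfRealType.exists_trace_bound`,
`Module.End.HasEigenvalue.re_sq_le`). In a basis adapted to the derived algebra, where the traces
vanish, a block decomposition of `|c|²` finishes the proof (`sum_structConst_sq_le`). -/

/-! ### Roots of solvable Lie algebras and the real type condition. -/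

theorem trace_eq_trace_restrict_add_trace_mapQ {K V : Type*} [Field K] [AddCommGroup V]
    [Module K V] [FiniteDimensional K V] (W : Submodule K V) (e : V →ₗ[K] V)
    (he : W ≤ W.comap e) :
    LinearMap.trace K V e =
      LinearMap.trace K W (e.restrict he) + LinearMap.trace K (V ⧸ W) (W.mapQ W e he) := by
  let bW := Module.finBasis K W
  let bQ := Module.finBasis K (V ⧸ W)
  let b := Module.Basis.sumQuot bW bQ
  rw [LinearMap.trace_eq_matrix_trace K b, LinearMap.trace_eq_matrix_trace K bW,
    LinearMap.trace_eq_matrix_trace K bQ]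
  simp only [Matrix.trace, Matrix.diag, Fintype.sum_sum_type]
  congr 1
  · refine Finset.sum_congr rfl fun i _ => ?_
    simp only [b, LinearMap.toMatrix_apply, Module.Basis.sumQuot_inl]
    apply Module.Basis.sumQuot_repr_inl_of_mem
  · refine Finset.sum_congr rfl fun i _ => ?_
    simp only [b, LinearMap.toMatrix_apply, Module.Basis.sumQuot_repr_inr]
    rw [← Module.Basis.sumQuot_inr bW bQ i, W.mapQ_apply]
    simp

/-- If `z - e` is surjective, so is the map it induces on the quotient, and in finite dimension
surjective means invertible. -/
theorem hasEigenvalue_of_hasEigenvalue_mapQ {K V : Type*} [Field K] [AddCommGroup V]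
    [Module K V] [FiniteDimensional K V] (W : Submodule K V) (e : V →ₗ[K] V)
    (he : W ≤ W.comap e) {z : K} (hz : Module.End.HasEigenvalue (W.mapQ W e he) z) :
    Module.End.HasEigenvalue e z := by
  rw [Module.End.hasEigenvalue_iff_mem_spectrum, spectrum.mem_iff] at hz ⊢
  contrapose! hz
  have hs : Function.Surjective (algebraMap K (Module.End K V) z - e) :=
    ((Module.End.isUnit_iff _).1 hz).2
  have hs' : Function.Surjective
      (algebraMap K (Module.End K (V ⧸ W)) z - (W.mapQ W e he : Module.End K (V ⧸ W))) := by
    intro y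
    obtain ⟨y, rfl⟩ := W.mkQ_surjective y
    obtain ⟨x, rfl⟩ := hs y
    exact ⟨W.mkQ x, by simp [Module.algebraMap_end_apply]⟩
  exact (Module.End.isUnit_iff _).2 ⟨LinearMap.injective_iff_surjective.2 hs', hs'⟩

/-- The weights of a module over a solvable Lie algebra, with multiplicity, as they are read off
from a complete flag of submodules. -/
theorem exists_weights_of_isSolvable {K L : Type*} [Field K] [IsAlgClosed K] [CharZero K]
    [LieRing L] [LieAlgebra K L] [LieAlgebra.IsSolvable L] (n : ℕ) :
    ∀ (M : Type*) [AddCommGroup M] [Module K M] [FiniteDimensional K M] [LieRingModule L M]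
      [LieModule K L M], Module.finrank K M = n →
    ∃ χ : Fin n → Module.Dual K L,
      (∀ i x, Module.End.HasEigenvalue (LieModule.toEnd K L M x) (χ i x)) ∧
      (∀ x z, Module.End.HasEigenvalue (LieModule.toEnd K L M x) z → ∃ i, χ i x = z) ∧
      (∀ i (x y : L), χ i ⁅x, y⁆ = 0) ∧
      ∀ x, LinearMap.trace K M (LieModule.toEnd K L M x ∘ₗ LieModule.toEnd K L M x) =
        ∑ i, χ i x ^ 2 := by
  induction n with
  | zero =>
    intro M _ _ _ _ _ hM
    have := Module.finrank_zero_iff.1 hM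
    refine ⟨Fin.elim0, fun i => i.elim0, fun x z hz => ?_, fun i => i.elim0, fun x => ?_⟩
    · obtain ⟨v, hv⟩ := hz.exists_hasEigenvector
      exact absurd (Subsingleton.elim v 0) hv.2
    · rw [Subsingleton.elim (LieModule.toEnd K L M x ∘ₗ LieModule.toEnd K L M x) 0]
      simp
  | succ n ih =>
    intro M _ _ _ _ _ hM
    have : Nontrivial M := Module.nontrivial_of_finrank_pos (R := K) (by omega)
    obtain ⟨χ₀, hχ₀⟩ := LieModule.exists_nontrivial_weightSpace_of_isSolvable K L M
    obtain ⟨⟨v, hv⟩, hv0⟩ := exists_ne (0 : LieModule.weightSpace M χ₀)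
    rw [LieModule.mem_weightSpace] at hv
    have hv0 : v ≠ 0 := fun h => hv0 (by simpa using h)
    -- The line through the common eigenvector given by Lie's theorem is a submodule; the induction
    -- continues on the quotient.
    let N : LieSubmodule K L M :=
      { Submodule.span K {v} with
        lie_mem := by
          intro x m hm
          obtain ⟨c, rfl⟩ := Submodule.mem_span_singleton.1 hm
          exact Submodule.mem_span_singleton.2 ⟨c * χ₀ x, by simp [hv, smul_smul]⟩ }
    have hNv : N.toSubmodule = Submodule.span K {v} := rfl
    have hN1 : Module.finrank K N.toSubmodule = 1 := by
      rw [hNv]; exact finrank_span_singleton hv0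
    have hQ : Module.finrank K (M ⧸ N) = n := by
      have := Submodule.finrank_quotient_add_finrank N.toSubmodule
      change Module.finrank K (M ⧸ N) + _ = _ at this
      omega
    obtain ⟨χ, h1, h4, h2, h3⟩ := ih (M ⧸ N) hQ
    have hmap : ∀ x, N.toSubmodule ≤ N.toSubmodule.comap (LieModule.toEnd K L M x) :=
      fun x m hm => N.lie_mem hm
    have hmap2 : ∀ x, N.toSubmodule ≤ N.toSubmodule.comap
        (LieModule.toEnd K L M x ∘ₗ LieModule.toEnd K L M x) :=
      fun x m hm => N.lie_mem (N.lie_mem hm)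
    have hq : ∀ x, LieModule.toEnd K L (M ⧸ N) x =
        N.toSubmodule.mapQ N.toSubmodule (LieModule.toEnd K L M x) (hmap x) := fun x => rfl
    have heig : ∀ x, Module.End.HasEigenvalue (LieModule.toEnd K L M x) (χ₀ x) := fun x =>
      Module.End.hasEigenvalue_of_hasEigenvector (x := v)
        ⟨Module.End.mem_eigenspace_iff.2 (hv x), hv0⟩
    refine ⟨Fin.cons χ₀ χ, fun i x => ?_, fun x z hz => ?_, fun i x y => ?_, fun x => ?_⟩
    · refine Fin.cases ?_ (fun i => ?_) i
      · exact heig x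
      · exact hasEigenvalue_of_hasEigenvalue_mapQ N.toSubmodule _ (hmap x) (h1 i x)
    · obtain ⟨w, hw, hw0⟩ := hz.exists_hasEigenvector
      rw [Module.End.mem_eigenspace_iff] at hw
      -- An eigenvector either lies on the line, with eigenvalue `χ₀ x`, or survives in the
      -- quotient.
      by_cases hwN : w ∈ N
      · obtain ⟨c, rfl⟩ := Submodule.mem_span_singleton.1 hwN
        refine ⟨0, ?_⟩
        rw [map_smul, LieModule.toEnd_apply_apply, hv, smul_comm] at hw
        exact smul_left_injective K hw0 hw
      · have hw' : LieModule.toEnd K L (M ⧸ N) x (N.toSubmodule.mkQ w) =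
            z • N.toSubmodule.mkQ w := by
          rw [← map_smul, ← hw]
          rfl
        have hw0' : N.toSubmodule.mkQ w ≠ 0 := by
          rw [Submodule.mkQ_apply, ne_eq, Submodule.Quotient.mk_eq_zero]
          exact hwN
        obtain ⟨i, hi⟩ := h4 x z (Module.End.hasEigenvalue_of_hasEigenvector
          ⟨Module.End.mem_eigenspace_iff.2 hw', hw0'⟩)
        exact ⟨i.succ, by simpa using hi⟩
    · refine Fin.cases ?_ (fun i => ?_) i
      · have h : χ₀ ⁅x, y⁆ • v = 0 := by
          rw [← hv, lie_lie, hv y, hv x, lie_smul, lie_smul, hv, hv, smul_smul, smul_smul,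
            mul_comm, sub_self]
        simpa [hv0] using h
      · exact h2 i x y
    · rw [trace_eq_trace_restrict_add_trace_mapQ N.toSubmodule _ (hmap2 x), Fin.sum_univ_succ]
      congr 1
      · have : (LieModule.toEnd K L M x ∘ₗ LieModule.toEnd K L M x).restrict (hmap2 x) =
            (χ₀ x ^ 2) • (LinearMap.id : N.toSubmodule →ₗ[K] N.toSubmodule) := by
          ext ⟨m, hm⟩
          obtain ⟨c, rfl⟩ := Submodule.mem_span_singleton.1 hm
          simp only [LinearMap.coe_restrict_apply, LinearMap.comp_apply, map_smul,
            LieModule.toEnd_apply_apply, hv, LinearMap.smul_apply, LinearMap.id_apply,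
            Submodule.coe_smul, smul_smul]
          congr 1
          ring
        rw [this, map_smul, LinearMap.trace_id, hN1]
        simp
      · simp only [Fin.cons_succ]
        rw [← h3 x]
        congr 1
        ext m
        rfl

open TensorProduct in
/-- The roots of a solvable real Lie algebra, with multiplicity. -/
theorem exists_roots_of_isSolvable (L : Type*) [LieRing L] [LieAlgebra ℝ L]
    [FiniteDimensional ℝ L] [LieAlgebra.IsSolvable L] :
    ∃ (n : ℕ) (α : Fin n → L →ₗ[ℝ] ℂ),
      (∀ i x, Module.End.HasEigenvalue ((LieAlgebra.ad ℝ L x).baseChange ℂ) (α i x)) ∧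
      (∀ x z, Module.End.HasEigenvalue ((LieAlgebra.ad ℝ L x).baseChange ℂ) z →
        ∃ i, α i x = z) ∧
      (∀ i (x y : L), α i ⁅x, y⁆ = 0) ∧
      ∀ x, ((LinearMap.trace ℝ L (LieAlgebra.ad ℝ L x ∘ₗ LieAlgebra.ad ℝ L x) : ℝ) : ℂ) =
        ∑ i, α i x ^ 2 := by
  obtain ⟨χ, h1, h2, h3, h4⟩ := exists_weights_of_isSolvable (K := ℂ) (L := ℂ ⊗[ℝ] L)
    (Module.finrank ℂ (ℂ ⊗[ℝ] L)) (ℂ ⊗[ℝ] L) rfl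
  have hb : ∀ x : L, LieModule.toEnd ℂ (ℂ ⊗[ℝ] L) (ℂ ⊗[ℝ] L) (1 ⊗ₜ x) =
      (LieAlgebra.ad ℝ L x).baseChange ℂ := fun x => LieModule.toEnd_baseChange ℝ ℂ L L x
  refine ⟨_, fun i => (χ i).restrictScalars ℝ ∘ₗ TensorProduct.mk ℝ ℂ L 1, fun i x => ?_,
    fun x z hz => ?_, fun i x y => ?_, fun x => ?_⟩
  · rw [← hb]; exact h1 i _
  · rw [← hb] at hz; exact h2 _ z hz
  · have := h3 i (1 ⊗ₜ x) (1 ⊗ₜ y)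
    rw [LieAlgebra.ExtendScalars.bracket_tmul, one_mul] at this
    exact this
  · have := h4 (1 ⊗ₜ x)
    rw [hb, ← LinearMap.baseChange_comp, LinearMap.trace_baseChange] at this
    exact this

/-- On a solvable Lie algebra, `tr (ad x)² = 0` for `x` in the derived algebra. -/
theorem trace_ad_sq_eq_zero_of_mem_derived {L : Type*} [LieRing L] [LieAlgebra ℝ L]
    [FiniteDimensional ℝ L] [LieAlgebra.IsSolvable L] {x : L}
    (hx : x ∈ Submodule.span ℝ {z : L | ∃ u v : L, ⁅u, v⁆ = z}) :
    LinearMap.trace ℝ L (LieAlgebra.ad ℝ L x ∘ₗ LieAlgebra.ad ℝ L x) = 0 := by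
  obtain ⟨n, α, -, -, h3, h4⟩ := exists_roots_of_isSolvable L
  have h : ∀ i, α i x = 0 := by
    intro i
    have : Submodule.span ℝ {z : L | ∃ u v : L, ⁅u, v⁆ = z} ≤ LinearMap.ker (α i) := by
      rw [Submodule.span_le]
      rintro _ ⟨u, v, rfl⟩
      exact h3 i u v
    exact this hx
  have := h4 x
  simpa [h] using this

/-- For a solvable Lie algebra of real type, the trace of `(ad x)²` is controlled from below by the
real parts of the eigenvalues of `ad x`. -/
theorem IsOfRealType.exists_trace_bound {L : Type*} [LieRing L] [LieAlgebra ℝ L]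
    [FiniteDimensional ℝ L] [LieAlgebra.IsSolvable L] (hreal : IsOfRealType L) :
    ∃ C : ℝ, 0 ≤ C ∧ ∀ (x : L) (B : ℝ),
      (∀ z : ℂ, Module.End.HasEigenvalue ((LieAlgebra.ad ℝ L x).baseChange ℂ) z → z.re ^ 2 ≤ B) →
      - LinearMap.trace ℝ L (LieAlgebra.ad ℝ L x ∘ₗ LieAlgebra.ad ℝ L x) ≤ C * B := by
  obtain ⟨n, α, h1, h2, -, h4⟩ := exists_roots_of_isSolvable L
  have hspan : ∀ j, Complex.imLm ∘ₗ α j ∈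
      Submodule.span ℝ (Set.range fun k => Complex.reLm ∘ₗ α k) := by
    intro j
    -- A form vanishing on the common kernel of finitely many forms is in their span. Where all real
    -- parts vanish, real type forces `ad x` to be nilpotent, so every root vanishes.
    refine mem_span_of_iInf_ker_le_ker fun x hx => ?_
    have hx : ∀ k, (α k x).re = 0 := by simpa [Submodule.mem_iInf] using hx
    obtain hnil | ⟨z, hz, hz0⟩ := hreal x
    · have hnil : IsNilpotent ((LieAlgebra.ad ℝ L x).baseChange ℂ) := by
        obtain ⟨m, hm⟩ := hnil
        exact ⟨m, by rw [← LinearMap.baseChange_pow, hm, LinearMap.baseChange_zero]⟩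
      have := (h1 j x).isNilpotent_of_isNilpotent hnil
      simp [this.eq_zero]
    · obtain ⟨k, rfl⟩ := h2 x z hz
      exact absurd (hx k) hz0
  choose c hc using fun j => (Submodule.mem_span_range_iff_exists_fun ℝ).1 (hspan j)
  -- Cauchy–Schwarz gives the squared coefficients; `n` counts the real parts, each with square at
  -- most `B`.
  refine ⟨∑ j, ∑ k, c j k ^ 2 * n, by positivity, fun x B hB => ?_⟩
  have him : ∀ j, (α j x).im = ∑ k, c j k * (α k x).re := by
    intro j
    have := LinearMap.congr_fun (hc j) x
    simpa using this.symm
  have htr : LinearMap.trace ℝ L (LieAlgebra.ad ℝ L x ∘ₗ LieAlgebra.ad ℝ L x) =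
      ∑ j, ((α j x).re ^ 2 - (α j x).im ^ 2) := by
    have := congrArg Complex.re (h4 x)
    rw [Complex.ofReal_re, Complex.re_sum] at this
    rw [this]
    refine Finset.sum_congr rfl fun j _ => ?_
    rw [pow_two, Complex.mul_re]; ring
  rw [htr, ← Finset.sum_neg_distrib, Finset.sum_mul]
  refine Finset.sum_le_sum fun j _ => ?_
  have hcs : (∑ k, c j k * (α k x).re) ^ 2 ≤ (∑ k, c j k ^ 2) * ∑ k, (α k x).re ^ 2 :=
    Finset.sum_mul_sq_le_sq_mul_sq _ _ _
  have hre : ∑ k, (α k x).re ^ 2 ≤ n * B := by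
    refine (Finset.sum_le_sum fun k _ => hB _ (h1 k x)).trans ?_
    simp
  rw [← him] at hcs
  have h0 : 0 ≤ ∑ k, c j k ^ 2 := by positivity
  rw [← Finset.sum_mul]
  nlinarith [mul_le_mul_of_nonneg_left hre h0, sq_nonneg (α j x).re]

/-! ### Real parts of eigenvalues and symmetric parts of matrices. -/

/-- The real parts of the eigenvalues of a real matrix are bounded by the norm of its symmetric
part. -/
theorem Matrix.re_sq_le_of_mulVec_eq {ι : Type*} [Fintype ι] [DecidableEq ι] (M : Matrix ι ι ℝ)
    {z : ℂ} {v : ι → ℂ} (hv : v ≠ 0) (h : (M.map (algebraMap ℝ ℂ)).mulVec v = z • v) :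
    z.re ^ 2 ≤ ∑ j, ∑ k, ((M j k + M k j) / 2) ^ 2 := by
  set N : ℝ := ∑ j, ((v j).re ^ 2 + (v j).im ^ 2) with hN
  have hNpos : 0 < N := by
    obtain ⟨i, hi⟩ := Function.ne_iff.1 hv
    refine Finset.sum_pos' (fun j _ => by positivity) ⟨i, Finset.mem_univ i, ?_⟩
    by_contra hcon
    have h1 := sq_nonneg (v i).re
    have h2 := sq_nonneg (v i).im
    apply hi
    apply Complex.ext
    · exact pow_eq_zero_iff (two_ne_zero) |>.1 (by linarith : (v i).re ^ 2 = 0)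
    · exact pow_eq_zero_iff (two_ne_zero) |>.1 (by linarith : (v i).im ^ 2 = 0)
  have hre : ∀ j, ∑ k, M j k * (v k).re = z.re * (v j).re - z.im * (v j).im := by
    intro j
    have := congrArg Complex.re (congrFun h j)
    simpa [Matrix.mulVec, dotProduct, Complex.re_sum] using this
  have him : ∀ j, ∑ k, M j k * (v k).im = z.re * (v j).im + z.im * (v j).re := by
    intro j
    have := congrArg Complex.im (congrFun h j)
    simpa [Matrix.mulVec, dotProduct, Complex.im_sum] using this
  -- `q` is the real part of `v v*`. Being symmetric, it pairs only with the symmetric part of `M`,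
  -- and its Frobenius norm is at most `N`.
  set q : ι → ι → ℝ := fun j k => (v j).re * (v k).re + (v j).im * (v k).im with hq
  have h1 : ∑ j, ∑ k, M j k * q j k = z.re * N := by
    rw [hN, Finset.mul_sum]
    refine Finset.sum_congr rfl fun j _ => ?_
    have : ∑ k, M j k * q j k =
        (v j).re * ∑ k, M j k * (v k).re + (v j).im * ∑ k, M j k * (v k).im := by
      rw [Finset.mul_sum, Finset.mul_sum, ← Finset.sum_add_distrib]
      exact Finset.sum_congr rfl fun k _ => by simp only [hq]; ring
    rw [this, hre, him]; ring
  have h2 : ∑ j, ∑ k, (M j k + M k j) / 2 * q j k = z.re * N := by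
    have h3 : ∑ j, ∑ k, M k j * q j k = z.re * N := by
      rw [Finset.sum_comm, ← h1]
      exact Finset.sum_congr rfl fun j _ => Finset.sum_congr rfl fun k _ => by
        simp only [hq]; ring
    have : ∑ j, ∑ k, (M j k + M k j) / 2 * q j k =
        (1 / 2) * (∑ j, ∑ k, M j k * q j k) + (1 / 2) * ∑ j, ∑ k, M k j * q j k := by
      simp only [Finset.mul_sum, ← Finset.sum_add_distrib]
      exact Finset.sum_congr rfl fun j _ => Finset.sum_congr rfl fun k _ => by ring
    rw [this, h1, h3]; ring
  have h3 : ∑ j, ∑ k, q j k ^ 2 ≤ N ^ 2 := by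
    rw [pow_two N, hN, Finset.sum_mul_sum]
    refine Finset.sum_le_sum fun j _ => Finset.sum_le_sum fun k _ => ?_
    simp only [hq]
    nlinarith [sq_nonneg ((v j).re * (v k).im - (v j).im * (v k).re)]
  have hcs : (∑ j, ∑ k, (M j k + M k j) / 2 * q j k) ^ 2 ≤
      (∑ j, ∑ k, ((M j k + M k j) / 2) ^ 2) * ∑ j, ∑ k, q j k ^ 2 := by
    simp only [← Fintype.sum_prod_type']
    exact Finset.sum_mul_sq_le_sq_mul_sq _ _ _
  rw [h2, mul_pow] at hcs
  have h0 : 0 ≤ ∑ j, ∑ k, ((M j k + M k j) / 2) ^ 2 := by positivity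
  exact le_of_mul_le_mul_right (hcs.trans (mul_le_mul_of_nonneg_left h3 h0)) (by positivity)

/-- The real parts of the eigenvalues of a real endomorphism are bounded by the norm of the
symmetric part of any of its matrices. -/
theorem Module.End.HasEigenvalue.re_sq_le {ι V : Type*} [Fintype ι] [DecidableEq ι]
    [AddCommGroup V] [Module ℝ V] (b : Module.Basis ι ℝ V) (T : V →ₗ[ℝ] V) {z : ℂ}
    (hz : Module.End.HasEigenvalue (T.baseChange ℂ) z) :
    z.re ^ 2 ≤ ∑ j, ∑ k,
      ((LinearMap.toMatrix b b T j k + LinearMap.toMatrix b b T k j) / 2) ^ 2 := by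
  obtain ⟨w, hw, hw0⟩ := hz.exists_hasEigenvector
  rw [Module.End.mem_eigenspace_iff] at hw
  let bC : Module.Basis ι ℂ (TensorProduct ℝ ℂ V) := Algebra.TensorProduct.basis ℂ b
  have hmul : ((LinearMap.toMatrix b b T).map (algebraMap ℝ ℂ)).mulVec (bC.repr w) =
      z • (bC.repr w : ι → ℂ) := by
    have h := LinearMap.toMatrix_mulVec_repr bC bC (T.baseChange ℂ) w
    rw [LinearMap.toMatrix_baseChange] at h
    rw [h, hw, map_smul, Finsupp.coe_smul]
  exact Matrix.re_sq_le_of_mulVec_eq _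
    (fun h => hw0 (bC.repr.map_eq_zero_iff.1 (DFunLike.coe_injective h))) hmul

/-! ### Orthonormal bases of an inner product. -/

namespace InnerMetric

section VectorSpace

variable {V : Type*} [AddCommGroup V] [Module ℝ V]

/-- A basis that is orthonormal for the inner product `g`. -/
def IsOrthonormalBasis (g : InnerMetric V) {ι : Type*} (b : Module.Basis ι ℝ V) : Prop :=
  (∀ i, g.form (b i) (b i) = 1) ∧ ∀ i j, i ≠ j → g.form (b i) (b j) = 0

/-- Every subspace has an adapted orthonormal basis. -/
theorem exists_isOrthonormalBasis_adapted [FiniteDimensional ℝ V] (g : InnerMetric V)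
    (W : Submodule ℝ V) :
    ∃ (u : Finset V) (b : Module.Basis u ℝ V) (p : u → Prop), g.IsOrthonormalBasis b ∧
      (∀ i, p i → b i ∈ W) ∧ ∀ i, ¬ p i → ∀ y ∈ W, g.form y (b i) = 0 := by
  let core : InnerProductSpace.Core ℝ V :=
    { inner := fun x y => g.form x y
      conj_inner_symm := fun x y => g.symm y x
      re_inner_nonneg := fun x => by
        rcases eq_or_ne x 0 with rfl | hx
        · simp
        · exact (g.pos x hx).le
      add_left := fun x y z => by simp
      smul_left := fun x y r => by simp
      definite := fun x hx => by
        by_contra h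
        exact (g.pos x h).ne' hx }
  let _ : NormedAddCommGroup V := core.toNormedAddCommGroup
  let _ : InnerProductSpace ℝ V := InnerProductSpace.ofCore core.toCore
  have hin : ∀ x y : V, inner ℝ x y = g.form x y := fun x y => rfl
  let w := stdOrthonormalBasis ℝ W
  have hw : Orthonormal ℝ (fun i => (w i : V)) :=
    w.orthonormal.comp_linearIsometry W.subtypeₗᵢ
  obtain ⟨u, b, hu, hb⟩ := hw.toSubtypeRange.exists_orthonormalBasis_extension
  have hon : ∀ i j, i ≠ j → g.form (b i) (b j) = 0 := fun i j hij =>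
    b.orthonormal.2 hij
  -- The predicate marks the vectors of the extended basis that come from the chosen basis of `W`.
  refine ⟨u, b.toBasis, fun i => (i : V) ∈ Set.range fun i => (w i : V), ⟨fun i => ?_, ?_⟩,
    ?_, ?_⟩
  · have := b.orthonormal.1 i
    rw [OrthonormalBasis.coe_toBasis, ← hin, real_inner_self_eq_norm_sq, this]; norm_num
  · simpa using hon
  · rintro i ⟨j, hj⟩
    rw [OrthonormalBasis.coe_toBasis, hb, ← hj]
    exact (w j).2
  · intro i hi y hy
    have hspan : W ≤ LinearMap.ker (g.form.flip (b i)) := by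
      have hWs : W = (Submodule.span ℝ (Set.range w)).map W.subtype := by
        rw [← OrthonormalBasis.coe_toBasis, w.toBasis.span_eq, Submodule.map_top,
          Submodule.range_subtype]
      rw [hWs, Submodule.map_span, Submodule.span_le]
      rintro _ ⟨_, ⟨j, rfl⟩, rfl⟩
      have hj : (w j : V) ∈ u := hu ⟨j, rfl⟩
      have hne : (⟨w j, hj⟩ : u) ≠ i := by
        rintro rfl
        exact hi ⟨j, rfl⟩
      have := hon _ _ hne
      rw [hb] at this
      simpa [hb] using this
    simpa using hspan hy

variable {ι : Type*} [Fintype ι] {g : InnerMetric V} {b : Module.Basis ι ℝ V}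

namespace IsOrthonormalBasis

theorem repr_apply (hb : g.IsOrthonormalBasis b) (x : V) (i : ι) : b.repr x i = g.form x (b i) := by
  conv_rhs => rw [← b.sum_repr x]
  rw [map_sum, LinearMap.sum_apply, Finset.sum_eq_single i]
  · simp [hb.1]
  · intro j _ hj
    simp [hb.2 j i hj]
  · simp

theorem sum_form_smul (hb : g.IsOrthonormalBasis b) (x : V) : ∑ i, g.form x (b i) • b i = x := by
  simp only [← hb.repr_apply, b.sum_repr]

theorem form_eq_sum (hb : g.IsOrthonormalBasis b) (x y : V) :
    g.form x y = ∑ i, g.form x (b i) * g.form y (b i) := by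
  conv_lhs => rw [← hb.sum_form_smul y]
  simp [mul_comm]

theorem form_map_eq_sum (hb : g.IsOrthonormalBasis b) (T : V →ₗ[ℝ] V) (x z : V) :
    g.form (T x) z = ∑ i, g.form x (b i) * g.form (T (b i)) z := by
  conv_lhs => rw [← hb.sum_form_smul x]
  simp

theorem toMatrix_apply [DecidableEq ι] (hb : g.IsOrthonormalBasis b) (T : V →ₗ[ℝ] V) (i j : ι) :
    LinearMap.toMatrix b b T i j = g.form (T (b j)) (b i) := by
  rw [LinearMap.toMatrix_apply, hb.repr_apply]

theorem trace_eq (hb : g.IsOrthonormalBasis b) (T : V →ₗ[ℝ] V) :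
    LinearMap.trace ℝ V T = ∑ i, g.form (T (b i)) (b i) := by
  classical
  rw [LinearMap.trace_eq_matrix_trace ℝ b]
  simp [Matrix.trace, hb.toMatrix_apply]

theorem endNorm_eq [FiniteDimensional ℝ V] (hb : g.IsOrthonormalBasis b) (T : V →ₗ[ℝ] V) :
    g.endNorm T = Real.sqrt (∑ i, ∑ j, g.form (T (b i)) (b j) ^ 2) := by
  rw [endNorm, hb.trace_eq]
  congr 1
  refine Finset.sum_congr rfl fun i _ => ?_
  have := LinearMap.BilinForm.isAdjointPairLeftAdjointOfNondegenerate g.form g.nondegenerate T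
    (T (b i)) (b i)
  rw [LinearMap.comp_apply, this, hb.form_eq_sum]
  exact Finset.sum_congr rfl fun j _ => (pow_two _).symm

end IsOrthonormalBasis

end VectorSpace

/-! ### Curvature in terms of structure constants. -/

section LieAlgebra

variable {L : Type*} [LieRing L] [LieAlgebra ℝ L]
  {ι : Type*} {g : InnerMetric L} {b : Module.Basis ι ℝ L}

/-- The structure constants of a metric Lie algebra in a basis. -/
def structConst (g : InnerMetric L) (b : ι → L) (i j k : ι) : ℝ := g.form ⁅b i, b j⁆ (b k)

theorem structConst_skew (g : InnerMetric L) (b : ι → L) (i j k : ι) :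
    g.structConst b i j k = - g.structConst b j i k := by
  rw [structConst, structConst, ← lie_skew, map_neg, LinearMap.neg_apply]

/-- The Christoffel symbols of a metric Lie algebra in terms of its structure constants. -/
noncomputable def christoffel (c : ι → ι → ι → ℝ) (i j k : ι) : ℝ :=
  (1 / 2) * (c i j k - c j k i + c k i j)

theorem IsOrthonormalBasis.trace_ad_sq_eq [Fintype ι] (hb : g.IsOrthonormalBasis b) (i : ι) :
    LinearMap.trace ℝ L (LieAlgebra.ad ℝ L (b i) ∘ₗ LieAlgebra.ad ℝ L (b i)) =
      ∑ j, ∑ k, g.structConst b i j k * g.structConst b i k j := by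
  rw [hb.trace_eq]
  refine Finset.sum_congr rfl fun j _ => ?_
  rw [LinearMap.comp_apply, hb.form_map_eq_sum]
  rfl

variable [FiniteDimensional ℝ L]

theorem form_leviCivita_basis (g : InnerMetric L) (b : ι → L) (i j k : ι) :
    g.form (g.leviCivita (b i) (b j)) (b k) = christoffel (g.structConst b) i j k :=
  g.form_leviCivita _ _ _

variable [Fintype ι]

namespace IsOrthonormalBasis

theorem ricci_eq (hb : g.IsOrthonormalBasis b) (i j : ι) :
    g.ricci (b i) (b j) = ∑ k, ∑ l,
      (christoffel (g.structConst b) i j l * christoffel (g.structConst b) k l k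
        - christoffel (g.structConst b) k j l * christoffel (g.structConst b) i l k
        - g.structConst b k i l * christoffel (g.structConst b) l j k) := by
  rw [ricci, hb.trace_eq]
  refine Finset.sum_congr rfl fun k _ => ?_
  simp only [Finset.sum_sub_distrib, LinearMap.coe_mk, AddHom.coe_mk, curvature,
    LinearMap.sub_apply, LinearMap.comp_apply, map_sub]
  congr 1
  · congr 1
    · rw [hb.form_map_eq_sum]
      simp only [form_leviCivita_basis]
    · rw [hb.form_map_eq_sum]
      simp only [form_leviCivita_basis]
  · have := hb.form_map_eq_sum (g.leviCivita.flip (b j)) ⁅b k, b i⁆ (b k)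
    simp only [LinearMap.flip_apply, form_leviCivita_basis] at this
    exact this

/-- Christoffel symbols are at most `3/2 √A`, so each summand of Ricci is at most `(9/4 + 9/4 + 3/2)
A = 6 A`. There are `n²` summands, and the norm of an `n × n` matrix contributes one more factor
`n`. -/
theorem ricciNorm_le (hb : g.IsOrthonormalBasis b) :
    g.ricciNorm ≤ 6 * (Fintype.card ι : ℝ) ^ 3 *
      ∑ i, ∑ j, ∑ k, g.structConst b i j k ^ 2 := by
  set c := g.structConst b with hc
  set A := ∑ i, ∑ j, ∑ k, c i j k ^ 2 with hA
  have hA0 : 0 ≤ A := by positivity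
  have hcA : ∀ i j k, |c i j k| ≤ Real.sqrt A := by
    intro i j k
    refine Real.abs_le_sqrt ?_
    calc c i j k ^ 2 ≤ ∑ k, c i j k ^ 2 :=
          Finset.single_le_sum (f := fun k => c i j k ^ 2) (fun _ _ => by positivity)
            (Finset.mem_univ k)
      _ ≤ ∑ j, ∑ k, c i j k ^ 2 :=
          Finset.single_le_sum (f := fun j => ∑ k, c i j k ^ 2) (fun _ _ => by positivity)
            (Finset.mem_univ j)
      _ ≤ A := Finset.single_le_sum (f := fun i => ∑ j, ∑ k, c i j k ^ 2)
            (fun _ _ => by positivity) (Finset.mem_univ i)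
  have hG : ∀ i j k, |christoffel c i j k| ≤ 3 / 2 * Real.sqrt A := by
    intro i j k
    have h1 := abs_le.1 (hcA i j k)
    have h2 := abs_le.1 (hcA j k i)
    have h3 := abs_le.1 (hcA k i j)
    rw [christoffel, abs_le]
    constructor <;> linarith [h1.1, h1.2, h2.1, h2.2, h3.1, h3.2]
  have hs : Real.sqrt A * Real.sqrt A = A := Real.mul_self_sqrt hA0
  have hs0 := Real.sqrt_nonneg A
  have hmul : ∀ {x y s t : ℝ}, 0 ≤ s → |x| ≤ s → |y| ≤ t → |x * y| ≤ s * t := by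
    intro x y s t h0 hx hy
    rw [abs_mul]
    exact mul_le_mul hx hy (abs_nonneg _) h0
  have hGG : ∀ i j k i' j' k', |christoffel c i j k * christoffel c i' j' k'| ≤ 9 / 4 * A :=
    fun i j k i' j' k' => (hmul (by positivity) (hG i j k) (hG i' j' k')).trans_eq (by
      rw [mul_mul_mul_comm, hs]; ring)
  have hcG : ∀ i j k i' j' k', |c i j k * christoffel c i' j' k'| ≤ 3 / 2 * A :=
    fun i j k i' j' k' => (hmul hs0 (hcA i j k) (hG i' j' k')).trans_eq (by
      rw [mul_left_comm, hs])
  have hric : ∀ i j, |g.ricci (b i) (b j)| ≤ 6 * (Fintype.card ι : ℝ) ^ 2 * A := by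
    intro i j
    rw [hb.ricci_eq]
    have hterm : ∀ k l, |christoffel c i j l * christoffel c k l k
        - christoffel c k j l * christoffel c i l k - c k i l * christoffel c l j k| ≤ 6 * A := by
      intro k l
      refine (abs_sub _ _).trans ?_
      have h1 := abs_sub (christoffel c i j l * christoffel c k l k)
        (christoffel c k j l * christoffel c i l k)
      linarith [hGG i j l k l k, hGG k j l i l k, hcG k i l l j k]
    calc _ ≤ ∑ _k : ι, ∑ _l : ι, 6 * A :=
          (Finset.abs_sum_le_sum_abs _ _).trans (Finset.sum_le_sum fun k _ =>
            (Finset.abs_sum_le_sum_abs _ _).trans (Finset.sum_le_sum fun l _ => hterm k l))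
      _ = _ := by simp; ring
  rw [ricciNorm, hb.endNorm_eq, Real.sqrt_le_left (by positivity)]
  calc _ ≤ ∑ _i : ι, ∑ _j : ι, (6 * (Fintype.card ι : ℝ) ^ 2 * A) ^ 2 :=
        Finset.sum_le_sum fun i _ => Finset.sum_le_sum fun j _ => by
          rw [form_ricciOp]
          exact sq_le_sq' (abs_le.1 (hric i j)).1 (abs_le.1 (hric i j)).2
    _ = _ := by simp; ring

/-- The middle sum is the trace of the Killing form with respect to `g`. The last is `|H|²`, with
`g(H, x) = tr (ad x)`; its sign lets it be dropped later. -/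
theorem scal_eq (hb : g.IsOrthonormalBasis b) :
    g.scal = - (1 / 4) * ∑ i, ∑ j, ∑ k, g.structConst b i j k ^ 2
      - (1 / 2) * ∑ i, ∑ j, ∑ k, g.structConst b i j k * g.structConst b i k j
      - ∑ i, (∑ j, g.structConst b i j j) ^ 2 := by
  have hskew := g.structConst_skew b
  have hscal : g.scal = ∑ i, g.ricci (b i) (b i) := by
    rw [scal, hb.trace_eq]
    simp only [form_ricciOp]
  simp only [hscal, hb.ricci_eq]
  set c := g.structConst b
  have hcyc : ∀ f : ι → ι → ι → ℝ, ∑ i, ∑ j, ∑ k, f i j k = ∑ i, ∑ j, ∑ k, f j k i := by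
    intro f
    conv_rhs => rw [Finset.sum_comm]
    exact Finset.sum_congr rfl fun i _ => Finset.sum_comm
  have hsw : ∀ f : ι → ι → ι → ℝ, ∑ i, ∑ j, ∑ k, f i j k = ∑ i, ∑ j, ∑ k, f j i k :=
    fun f => Finset.sum_comm
  have hsw' : ∀ f : ι → ι → ι → ℝ, ∑ i, ∑ j, ∑ k, f i j k = ∑ i, ∑ j, ∑ k, f i k j :=
    fun f => Finset.sum_congr rfl fun i _ => Finset.sum_comm
  have hself : ∀ i k, c i i k = 0 := fun i k => by linarith [hskew i i k]
  have hterm : ∀ i k l, christoffel c i i l * christoffel c k l k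
      - christoffel c k i l * christoffel c i l k - c k i l * christoffel c l i k =
      - (c l i i * c l k k) - (3 / 4) * c k i l ^ 2 + (1 / 4) * c i l k ^ 2
        + (1 / 4) * c l k i ^ 2 + (1 / 2) * (c l i k * c l k i)
        - (1 / 2) * (c i k l * c i l k) - (1 / 2) * (c k i l * c k l i) := by
    intro i k l
    simp only [christoffel, hself, hskew i l i, hskew k l k, hskew l i k, hskew i k l, hskew k l i]
    ring
  simp only [hterm, Finset.sum_add_distrib, Finset.sum_sub_distrib, Finset.sum_neg_distrib,
    ← Finset.mul_sum]
  -- Up to renaming indices only three sums occur. Their coefficients add up to `-3/4 + 1/4 + 1/4`,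
  -- `1/2 - 1/2 - 1/2` and `-1`.
  have e1 := hsw fun i j k => c i j k ^ 2
  have e2 := hsw' fun i j k => c i j k ^ 2
  have e3 := (hcyc fun i j k => c i j k ^ 2).trans (hsw' fun i j k => c j k i ^ 2)
  have e4 := (hcyc fun i j k => c i j k * c i k j).trans (hcyc fun i j k => c j k i * c j i k)
  have e5 := hsw fun i j k => c i j k * c i k j
  have e6 := (hcyc fun i j k => c i j j * c i k k).trans (hcyc fun i j k => c j k k * c j i i)
  have e7 : ∑ i, (∑ j, c i j j) ^ 2 = ∑ i, ∑ j, ∑ k, c i j j * c i k k :=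
    Finset.sum_congr rfl fun i _ => by rw [pow_two, Finset.sum_mul_sum]
  rw [e7, e6, ← e1, ← e2, ← e3, ← e4, ← e5]
  ring

end IsOrthonormalBasis

end LieAlgebra
end InnerMetric

/-! ### The block estimate and the conclusion. -/

/-- The algebraic estimate that bounds the structure constants of a solvable metric Lie algebra of
real type by its scalar curvature. The indices with `p` belong to a subspace that contains all
brackets. -/
theorem sum_structConst_sq_le {ι : Type*} [Fintype ι] {c : ι → ι → ι → ℝ} {p : ι → Prop} {C : ℝ}
    (hC0 : 0 ≤ C) (hskew : ∀ i j k, c i j k = - c j i k) (hp : ∀ i j k, ¬ p k → c i j k = 0)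
    (hkill : ∀ i, p i → ∑ j, ∑ k, c i j k * c i k j = 0)
    (hC : ∀ i, - ∑ j, ∑ k, c i j k * c i k j ≤ C * ∑ j, ∑ k, ((c i k j + c i j k) / 2) ^ 2) :
    ∑ i, ∑ j, ∑ k, c i j k ^ 2 ≤ (4 + 4 * C) *
      ((1 / 4) * ∑ i, ∑ j, ∑ k, c i j k ^ 2 + (1 / 2) * ∑ i, ∑ j, ∑ k, c i j k * c i k j) := by
  classical
  set χ : ι → ℝ := fun i => if p i then 1 else 0 with hχ
  have hχ0 : ∀ i, 0 ≤ χ i := fun i => by simp only [hχ]; split_ifs <;> norm_num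
  have hχ1 : ∀ i, 0 ≤ 1 - χ i := fun i => by simp only [hχ]; split_ifs <;> norm_num
  have hχχ : ∀ i, χ i * χ i = χ i := fun i => by simp only [hχ]; split_ifs <;> norm_num
  have hχc : ∀ i j k, χ k * c i j k = c i j k := fun i j k => by
    by_cases h : p k
    · simp [hχ, h]
    · simp [hp i j k h]
  -- `U i` and `V i` are the squared norms of `ad (b i)` on the complement of the distinguished
  -- subspace and on that subspace; `t i` is `tr (ad (b i))²`.
  set U : ι → ℝ := fun i => ∑ j, ∑ k, (1 - χ j) * c i j k ^ 2 with hU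
  set V : ι → ℝ := fun i => ∑ j, ∑ k, χ j * c i j k ^ 2 with hV
  set t : ι → ℝ := fun i => ∑ j, ∑ k, c i j k * c i k j with ht
  have hU0 : ∀ i, 0 ≤ U i := fun i =>
    Finset.sum_nonneg fun j _ => Finset.sum_nonneg fun k _ => mul_nonneg (hχ1 j) (sq_nonneg _)
  have hV0 : ∀ i, 0 ≤ V i := fun i =>
    Finset.sum_nonneg fun j _ => Finset.sum_nonneg fun k _ => mul_nonneg (hχ0 j) (sq_nonneg _)
  have hf : ∀ i, ∑ j, ∑ k, c i j k ^ 2 = U i + V i := fun i => by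
    simp only [hU, hV, ← Finset.sum_add_distrib]
    exact Finset.sum_congr rfl fun j _ => Finset.sum_congr rfl fun k _ => by ring
  have hσ : ∀ i, ∑ j, ∑ k, ((c i k j + c i j k) / 2) ^ 2 = (1 / 2) * (U i + V i + t i) := by
    intro i
    have h1 : ∑ j, ∑ k, c i k j ^ 2 = U i + V i := by rw [Finset.sum_comm, hf]
    have h2 : ∑ j, ∑ k, ((c i k j + c i j k) / 2) ^ 2 = (1 / 4) * ∑ j, ∑ k, c i k j ^ 2 +
        (1 / 4) * ∑ j, ∑ k, c i j k ^ 2 + (1 / 2) * t i := by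
      simp only [ht, Finset.mul_sum, ← Finset.sum_add_distrib]
      exact Finset.sum_congr rfl fun j _ => Finset.sum_congr rfl fun k _ => by ring
    rw [h2, h1, hf]; ring
  -- Brackets land in the subspace, so only its diagonal block `M` contributes to `t i = tr M²`.
  -- Then `V i + t i = ½|M + Mᵀ|²`.
  have hVt : ∀ i, 0 ≤ V i + t i := by
    intro i
    have h1 : V i = ∑ j, ∑ k, (χ j * c i j k) ^ 2 := by
      simp only [hV, mul_pow, pow_two (χ _), hχχ]
    have h2 : V i = ∑ j, ∑ k, (χ k * c i k j) ^ 2 := by rw [h1, Finset.sum_comm]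
    have h3 : t i = ∑ j, ∑ k, (χ j * c i j k) * (χ k * c i k j) :=
      Finset.sum_congr rfl fun j _ => Finset.sum_congr rfl fun k _ => by
        rw [mul_mul_mul_comm, mul_comm (χ j), mul_mul_mul_comm, hχc, hχc]
    have h4 : V i + t i = (1 / 2) * ∑ j, ∑ k, (χ j * c i j k + χ k * c i k j) ^ 2 := by
      have : V i + t i = (1 / 2) * V i + (1 / 2) * V i + t i := by ring
      rw [this]
      nth_rw 1 [h1]
      rw [h2, h3]
      simp only [Finset.mul_sum, ← Finset.sum_add_distrib]
      exact Finset.sum_congr rfl fun j _ => Finset.sum_congr rfl fun k _ => by ring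
    rw [h4]
    positivity
  have hχt : ∀ i, (1 - χ i) * t i = t i := by
    intro i
    by_cases h : p i
    · rw [show t i = 0 from hkill i h, mul_zero]
    · simp [hχ, h]
  set E := ∑ i, (1 - χ i) * U i with hE
  set D := ∑ i, (1 - χ i) * V i with hD
  set F := ∑ i, χ i * V i with hF
  set τ := ∑ i, t i with hτ
  have hE0 : 0 ≤ E := Finset.sum_nonneg fun i _ => mul_nonneg (hχ1 i) (hU0 i)
  have hF0 : 0 ≤ F := Finset.sum_nonneg fun i _ => mul_nonneg (hχ0 i) (hV0 i)
  have hDτ : 0 ≤ D + τ := by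
    have : D + τ = ∑ i, (1 - χ i) * (V i + t i) := by
      simp only [hD, hτ, ← Finset.sum_add_distrib]
      exact Finset.sum_congr rfl fun i _ => by rw [mul_add, hχt]
    rw [this]
    exact Finset.sum_nonneg fun i _ => mul_nonneg (hχ1 i) (hVt i)
  -- The trace bound is summed over complementary indices only, since `t i` vanishes at the others;
  -- this keeps `F` and the second copy of `D` out of the right-hand side.
  have hτC : - τ ≤ C * ((1 / 2) * (E + D + τ)) := by
    have : E + D + τ = ∑ i, (1 - χ i) * (U i + V i + t i) := by
      simp only [hE, hD, hτ, ← Finset.sum_add_distrib]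
      exact Finset.sum_congr rfl fun i _ => by rw [mul_add, mul_add, hχt]
    rw [this, hτ, ← Finset.sum_neg_distrib, Finset.mul_sum, Finset.mul_sum]
    refine Finset.sum_le_sum fun i _ => ?_
    have h1 := hC i
    rw [hσ] at h1
    have h2 := mul_le_mul_of_nonneg_left h1 (hχ1 i)
    change (1 - χ i) * - t i ≤ _ at h2
    rw [mul_neg, hχt] at h2
    exact h2.trans_eq (by ring)
  -- Skew-symmetry identifies the two mixed blocks.
  have hDU : ∑ i, χ i * U i = D := by
    simp only [hD, hU, hV, Finset.mul_sum]
    rw [Finset.sum_comm]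
    refine Finset.sum_congr rfl fun i _ => Finset.sum_congr rfl fun j _ =>
      Finset.sum_congr rfl fun k _ => ?_
    rw [hskew j i k]; ring
  have hA : ∑ i, ∑ j, ∑ k, c i j k ^ 2 = E + 2 * D + F := by
    have : E + 2 * D + F = E + ∑ i, χ i * U i + D + F := by rw [hDU]; ring
    rw [this]
    simp only [hE, hD, hF, ← Finset.sum_add_distrib, hf]
    exact Finset.sum_congr rfl fun i _ => by ring
  change _ ≤ (4 + 4 * C) * (_ + 1 / 2 * τ)
  rw [hA]
  -- The right side is `(1 + C)(E + F) + (2 + 2C)(D + τ)`. Subtracting the left side and using `-2τ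
  -- ≤ C(E + D + τ)` leaves at least `C F + C(D + τ) ≥ 0`.
  nlinarith [mul_nonneg hC0 hDτ, mul_nonneg hC0 hF0, mul_nonneg hC0 hE0]

/-- On a solvable Lie algebra of real type, the Ricci curvature of an inner product is bounded by
its scalar curvature, uniformly in the inner product. -/
theorem IsOfRealType.exists_ricciNorm_le {L : Type*} [LieRing L] [LieAlgebra ℝ L]
    [FiniteDimensional ℝ L] [LieAlgebra.IsSolvable L] (hreal : IsOfRealType L) :
    ∃ C : ℝ, 0 < C ∧ ∀ g : InnerMetric L, g.ricciNorm ≤ C * |g.scal| := by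
  classical
  obtain ⟨C, hC0, hC⟩ := hreal.exists_trace_bound
  set N : ℝ := 6 * (Module.finrank ℝ L : ℝ) ^ 3 with hN
  -- The `+ 1` keeps the constant positive even in dimension zero, where `N = 0`.
  refine ⟨N * (4 + 4 * C) + 1, by positivity, fun g => ?_⟩
  obtain ⟨u, b, p, hb, hpW, hpn⟩ := g.exists_isOrthonormalBasis_adapted
    (Submodule.span ℝ {z : L | ∃ u v : L, ⁅u, v⁆ = z})
  have hnorm := hb.ricciNorm_le
  rw [← Module.finrank_eq_card_basis b, ← hN] at hnorm
  have hle : ∑ i, ∑ j, ∑ k, g.structConst b i j k ^ 2 ≤ (4 + 4 * C) * |g.scal| := by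
    refine (sum_structConst_sq_le (p := p) hC0 (g.structConst_skew b) ?_ ?_ ?_).trans
      (mul_le_mul_of_nonneg_left ?_ (by positivity))
    · exact fun i j k hk => hpn k hk _ (Submodule.subset_span ⟨_, _, rfl⟩)
    · intro i hi
      rw [← hb.trace_ad_sq_eq]
      exact trace_ad_sq_eq_zero_of_mem_derived (hpW i hi)
    · intro i
      rw [← hb.trace_ad_sq_eq]
      refine hC (b i) _ fun z hz => ?_
      have := hz.re_sq_le b
      simp only [hb.toMatrix_apply, LieAlgebra.ad_apply] at this
      exact this
    · refine le_trans ?_ (neg_le_abs _)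
      rw [hb.scal_eq]
      have : 0 ≤ ∑ i, (∑ j, g.structConst b i j j) ^ 2 := by positivity
      linarith
  have h1 := mul_le_mul_of_nonneg_left hle (by positivity : 0 ≤ N)
  linarith [abs_nonneg g.scal]

theorem mainTheorem3 (S : Type*) [TopologicalSpace S] [ChartedSpace E7 S] [Group S]
    [LieGroup 𝓘(ℝ, E7) ∞ S]
    (hnonab : ∃ a b : S, a * b ≠ b * a)
    (hsolv : LieAlgebra.IsSolvable (GroupLieAlgebra 𝓘(ℝ, E7) S))
    (hreal : IsOfRealType (GroupLieAlgebra 𝓘(ℝ, E7) S)) :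
    ∃ C : ℝ, 0 < C ∧
      ∀ (ψ : LeftInvariantG2Structure S) (g : InnerMetric (GroupLieAlgebra 𝓘(ℝ, E7) S)),
        IsMetricOf g (ψ.form 1) → g.ricciNorm ≤ C * |g.scal| := by
  obtain ⟨C, hC, h⟩ := hreal.exists_ricciNorm_le
  exact ⟨C, hC, fun _ g _ => h g⟩
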